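/- Let $g$ be the completely multiplicative function on the positive integers with $g(p)=-1$ for every prime $p\equiv 3\pmod 4$ and $g(p)=1$ for every other prime $p$. Let $$\gamma=\sum_{n=1}^{\infty}\frac{1+g(n)}{2}\,2^{-n}$$ be the Gaussian Liouville number, and let $G(z)=\sum_{n=1}^{\infty}g(n)z^{n}$ for complex $|z|<1$ be the generating function of $g$. Theorem. The series defining $\gamma$ and $G(1/2)$ converge, $$G\left(\tfrac12\right)=\sum_{k=0}^{\infty}\frac{1}{2^{2^k}+2^{-2^k}},\qquad \gamma=\frac{1+G(1/2)}{2},$$ and both $\gamma$ and $G(1/2)=\sum_{k\ge 0}\frac{1}{2^{2^k}+2^{-2^k}}$ are transcendental over $\mathbb{Q}$. -/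

import Mathlib

/-- The Gaussian Liouville function `g`: the completely multiplicative function with `g p = -1` for
the primes `p` congruent to `3` modulo `4` and `g p = 1` for all other primes, that is, the product
of these values over the prime factors of `n`, counted with multiplicity. Only its values at `n ≥ 1`
matter. -/
def gaussLiouville (n : ℕ) : ℤ :=
  (n.primeFactorsList.map fun p => if p % 4 = 3 then (-1 : ℤ) else 1).prod

theorem gaussLiouville_one : gaussLiouville 1 = 1 := by
  simp [gaussLiouville]

theorem gaussLiouville_mul {m n : ℕ} (hm : m ≠ 0) (hn : n ≠ 0) :
    gaussLiouville (m * n) = gaussLiouville m * gaussLiouville n := by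
  unfold gaussLiouville
  rw [((Nat.perm_primeFactorsList_mul hm hn).map _).prod_eq, List.map_append, List.prod_append]

theorem gaussLiouville_prime {p : ℕ} (hp : p.Prime) :
    gaussLiouville p = if p % 4 = 3 then -1 else 1 := by
  simp [gaussLiouville, Nat.primeFactorsList_prime hp]

/-- The Gaussian Liouville number `γ = ∑_{n ≥ 1} ((1 + g n) / 2) * 2⁻ⁿ`. The sum over `n ≥ 1` is
written with the index shifted by one. -/
noncomputable def gaussLiouvilleNumber : ℝ :=
  ∑' n : ℕ, ((1 + (gaussLiouville (n + 1) : ℝ)) / 2) * (1 / 2 ^ (n + 1))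

/-- The generating function `G z = ∑_{n ≥ 1} g n * zⁿ` of the Gaussian Liouville function, used for
`|z| < 1`. -/
noncomputable def gaussLiouvilleGenFun (z : ℂ) : ℂ :=
  ∑' n : ℕ, (gaussLiouville (n + 1) : ℂ) * z ^ (n + 1)

/-!
The proof is Mahler's method. Since `g (2 * n) = g n` and `g` agrees on odd numbers with the
quadratic character modulo `4`, splitting the generating function by parity gives the functional
equation `G x = G (x ^ 2) + x / (1 + x ^ 2)` (`isMahler_gaussLiouvilleSeries`). Iterating it from
`1 / 2` gives the series for `G (1 / 2)`; because `γ = (1 + G (1 / 2)) / 2`, it remains to show that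
`θ = G (1 / 2)` is transcendental.

`G` is transcendental over the polynomials: as `x → 1` it grows like a constant multiple of
`log (1 / (1 - x))`, and a function that tends to infinity more slowly than every negative power of
`1 - x` satisfies no polynomial relation (`eq_zero_of_eval₂_eq_zero_of_tendsto`,
`IsMahler.eq_zero_of_sum_eq_zero`).

Suppose that `θ` is algebraic of degree `d`. Counting coefficients, there is a nonzero integer
polynomial of degree less than `m` in each variable such that `E x = ∑ c i j * x ^ i * G x ^ j`
vanishes at `0` to order at least `N = m ^ 2 - m` (`exists_coeff_sum_eq_zero`), and `E` is not
identically zero. Put `B = 2 ^ 2 ^ k`. Then `E (1 / B)` is nonzero for large `k` and is `O(B ^ (-N))`.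
On the other hand `G (1 / B) = θ - s / D` with integers `s`, `D` and `D ≤ B ^ 2`, so `E (1 / B)` is an
element of `ℚ(θ)` with bounded conjugates and a denominator `O(B ^ (3 * m))`; Liouville's inequality
bounds it below by a constant multiple of `B ^ (-3 * m * d)` (`exists_one_le_mul_abs_sum`). For
`m = 3 * d + 2` the two bounds are incompatible. All estimates take place on the real interval
`(-1, 1)`, for the ring `discSeries` of integer power series converging there.
-/

/-! ### Integer power series converging on the unit interval -/

/-- The ring of power series with integer coefficients that converge absolutely at every real point
of the open unit disc. -/
def discSeries : Subring (PowerSeries ℤ) where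
  carrier := {f | ∀ x : ℝ, |x| < 1 → Summable fun n => ‖(f.coeff n : ℝ) * x ^ n‖}
  zero_mem' := fun x _ => by simp
  one_mem' := fun x _ => by
    refine summable_of_ne_finset_zero (s := {0}) fun n hn => ?_
    have : n ≠ 0 := by simpa using hn
    simp [PowerSeries.coeff_one, this]
  add_mem' := fun {f g} hf hg x hx => by
    refine Summable.of_nonneg_of_le (fun _ => norm_nonneg _) (fun n => ?_) ((hf x hx).add (hg x hx))
    rw [map_add, Int.cast_add, add_mul]
    exact norm_add_le _ _
  neg_mem' := fun {f} hf x hx => by simpa using hf x hx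
  mul_mem' := fun {f g} hf hg x hx => by
    refine (summable_norm_sum_mul_antidiagonal_of_summable_norm (hf x hx) (hg x hx)).congr
      fun n => ?_
    rw [PowerSeries.coeff_mul, Int.cast_sum, Finset.sum_mul]
    refine congrArg _ (Finset.sum_congr rfl fun ij hij => ?_)
    rw [← Finset.HasAntidiagonal.mem_antidiagonal.mp hij]
    push_cast
    ring

namespace discSeries

theorem summable_norm (f : discSeries) {x : ℝ} (hx : |x| < 1) :
    Summable fun n => ‖((f : PowerSeries ℤ).coeff n : ℝ) * x ^ n‖ :=
  f.2 x hx

/-- Summation of a convergent power series at a point `x` of the open unit interval. -/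
noncomputable def eval (x : ℝ) (hx : |x| < 1) : discSeries →+* ℝ where
  toFun f := ∑' n, ((f : PowerSeries ℤ).coeff n : ℝ) * x ^ n
  map_zero' := by simp
  map_one' := by
    rw [tsum_eq_single 0 fun n hn => by simp [PowerSeries.coeff_one, hn]]
    simp
  map_add' f g := by
    rw [← (summable_norm f hx).of_norm.tsum_add (summable_norm g hx).of_norm]
    refine tsum_congr fun n => ?_
    simp [add_mul]
  map_mul' f g := by
    rw [tsum_mul_tsum_eq_tsum_sum_antidiagonal_of_summable_norm (summable_norm f hx)
      (summable_norm g hx)]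
    refine tsum_congr fun n => ?_
    rw [Subring.coe_mul, PowerSeries.coeff_mul, Int.cast_sum, Finset.sum_mul]
    refine Finset.sum_congr rfl fun ij hij => ?_
    rw [← Finset.HasAntidiagonal.mem_antidiagonal.mp hij]
    push_cast
    ring

theorem eval_apply (f : discSeries) {x : ℝ} (hx : |x| < 1) :
    eval x hx f = ∑' n, ((f : PowerSeries ℤ).coeff n : ℝ) * x ^ n := rfl

theorem hasSum_eval (f : discSeries) {x : ℝ} (hx : |x| < 1) :
    HasSum (fun n => ((f : PowerSeries ℤ).coeff n : ℝ) * x ^ n) (eval x hx f) :=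
  (summable_norm f hx).of_norm.hasSum

/-- The variable, as a convergent power series. -/
noncomputable def X : discSeries :=
  ⟨PowerSeries.X, fun x _ => by
    refine summable_of_ne_finset_zero (s := {1}) fun n hn => ?_
    have : n ≠ 1 := by simpa using hn
    simp [PowerSeries.coeff_X, this]⟩

theorem eval_X {x : ℝ} (hx : |x| < 1) : eval x hx X = x := by
  rw [eval_apply, tsum_eq_single 1 fun n hn => by simp [X, PowerSeries.coeff_X, hn]]
  simp [X]

/-- The sum of the absolute values of the terms at `1 / 2`. -/
noncomputable def halfNorm (f : discSeries) : ℝ :=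
  ∑' n, ‖((f : PowerSeries ℤ).coeff n : ℝ) * (1 / 2) ^ n‖

theorem halfNorm_nonneg (f : discSeries) : 0 ≤ halfNorm f :=
  tsum_nonneg fun _ => norm_nonneg _

/-- A series vanishing to order `N` at `0` is `O(x ^ N)`, by comparison with the point `1 / 2`. -/
theorem abs_eval_le (f : discSeries) {N : ℕ}
    (hN : ∀ n < N, (f : PowerSeries ℤ).coeff n = 0) {x : ℝ} (hx : |x| < 1) (h0 : 0 ≤ x)
    (h2 : x ≤ 1 / 2) : |eval x hx f| ≤ (2 * x) ^ N * halfNorm f := by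
  have hs := summable_norm f (x := 1 / 2) (by norm_num [abs_of_pos])
  rw [eval_apply, ← Real.norm_eq_abs, halfNorm, ← tsum_mul_left]
  refine (norm_tsum_le_tsum_norm (summable_norm f hx)).trans
    ((summable_norm f hx).tsum_le_tsum (fun n => ?_) (hs.mul_left _))
  rcases lt_or_ge n N with h | h
  · simp [hN n h]
  · rw [norm_mul, norm_mul, norm_pow, norm_pow, Real.norm_of_nonneg h0,
      Real.norm_of_nonneg (by norm_num : (0 : ℝ) ≤ 1 / 2), mul_left_comm]
    refine mul_le_mul_of_nonneg_left ?_ (norm_nonneg _)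
    calc x ^ n = (2 * x) ^ n * (1 / 2) ^ n := by rw [← mul_pow]; congr 1; ring
      _ ≤ (2 * x) ^ N * (1 / 2) ^ n := by
        gcongr ?_ * _
        exact pow_le_pow_of_le_one (by positivity) (by linarith) h

/-- A nonzero series has no zeros at small positive points: its lowest term dominates there. -/
theorem exists_eval_ne_zero (f : discSeries) (hf : f ≠ 0) :
    ∃ δ > 0, ∀ x (hx : |x| < 1), 0 < x → x < δ → eval x hx f ≠ 0 := by
  have hex : ∃ n, (f : PowerSeries ℤ).coeff n ≠ 0 := by
    by_contra! h
    exact hf (Subtype.ext (PowerSeries.ext fun n => by simpa using h n))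
  classical
  set m := Nat.find hex with hm
  have hm0 : (f : PowerSeries ℤ).coeff m ≠ 0 := Nat.find_spec hex
  set c := (f : PowerSeries ℤ).coeff m with hc
  -- remove the lowest term and estimate the rest
  set f' : discSeries := f - (c : discSeries) * X ^ m with hf'
  have hco : ∀ n, ((f' : discSeries) : PowerSeries ℤ).coeff n =
      (f : PowerSeries ℤ).coeff n - if n = m then c else 0 := by
    intro n
    have : ((f' : discSeries) : PowerSeries ℤ) = (f : PowerSeries ℤ) -
        PowerSeries.C c * PowerSeries.X ^ m := by
      simp [hf', X]
    rw [this, map_sub, PowerSeries.coeff_C_mul, PowerSeries.coeff_X_pow]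
    simp
  have hlow : ∀ n < m + 1, ((f' : discSeries) : PowerSeries ℤ).coeff n = 0 := by
    intro n hn
    rw [hco]
    rcases Nat.lt_succ_iff_lt_or_eq.mp hn with h | rfl
    · rw [if_neg h.ne, sub_zero]
      simpa using Nat.find_min hex h
    · simp [hc]
  have hpos : 0 < 2 ^ (m + 1) * (halfNorm f' + 1) := by
    have := halfNorm_nonneg f'
    positivity
  refine ⟨min (1 / 2) (1 / (2 ^ (m + 1) * (halfNorm f' + 1))), by positivity, ?_⟩
  intro x hx h0 hδ hz
  have hb := abs_eval_le f' hlow hx h0.le (hδ.le.trans (min_le_left _ _))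
  have he : eval x hx f' = - (c * x ^ m) := by
    simp [hf', hz, eval_X]
  rw [he, abs_neg, abs_mul, abs_of_pos (pow_pos h0 m)] at hb
  have hc1 : (1 : ℝ) ≤ |(c : ℝ)| := by exact_mod_cast Int.one_le_abs hm0
  have hx2 : x * (2 ^ (m + 1) * (halfNorm f' + 1)) < 1 := by
    rw [← lt_div_iff₀ hpos]
    exact hδ.trans_le (min_le_right _ _)
  have hxm := pow_pos h0 m
  have h3 : x ^ m ≤ x ^ m * (x * (2 ^ (m + 1) * halfNorm f')) := by
    calc x ^ m ≤ |(c : ℝ)| * x ^ m := le_mul_of_one_le_left hxm.le hc1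
      _ ≤ _ := hb
      _ = _ := by rw [mul_pow, pow_succ x]; ring
  have h4 : 1 ≤ x * (2 ^ (m + 1) * halfNorm f') := by
    by_contra! h
    nlinarith
  have h5 : 0 < x * 2 ^ (m + 1) := by positivity
  nlinarith

end discSeries

/-! ### Transcendence of a solution over the polynomials -/

open Filter Topology Polynomial in
/-- A function whose value at points `x k → 1` tends to infinity, but slower than any negative power
of `1 - x k`, satisfies no polynomial relation. After division by a power of `X - 1` some
coefficient of the relation survives at `x = 1`, and the relation specialized there is a nonzero
polynomial in one variable that tends to `0` along the values. -/
theorem eq_zero_of_eval₂_eq_zero_of_tendsto {P : ℤ[X][X]} {x t : ℕ → ℝ} (hx1 : ∀ k, x k ≠ 1)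
    (hx : Tendsto x atTop (𝓝 1)) (ht : Tendsto t atTop atTop)
    (hxt : ∀ j : ℕ, Tendsto (fun k => (x k - 1) * t k ^ j) atTop (𝓝 0))
    (hP : ∀ k, (P.eval₂ (aeval (x k) : ℤ[X] →ₐ[ℤ] ℝ).toRingHom (t k)) = 0) : P = 0 := by
  by_contra hP0
  have hprime : Prime (C (X - 1 : ℤ[X])) := prime_C_iff.mpr (by simpa using prime_X_sub_C (1 : ℤ))
  obtain ⟨n, Q, hQ, rfl⟩ := WfDvdMonoid.max_power_factor hP0 hprime.irreducible
  have hQ0 : ∀ k, (Q.eval₂ (aeval (x k) : ℤ[X] →ₐ[ℤ] ℝ).toRingHom (t k)) = 0 := by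
    intro k
    have := hP k
    rw [eval₂_mul, eval₂_pow, eval₂_C] at this
    refine (mul_eq_zero.mp this).resolve_left (pow_ne_zero _ ?_)
    simpa [sub_eq_zero] using hx1 k
  -- the relation specialized at `x = 1`
  set q : ℝ[X] := Q.map (aeval (1 : ℝ) : ℤ[X] →ₐ[ℤ] ℝ).toRingHom with hq
  have hq0 : q ≠ 0 := by
    intro h0
    refine hQ ((C_dvd_iff_dvd_coeff _ _).mpr fun j => ?_)
    have h1 : (aeval (1 : ℝ) (Q.coeff j)) = 0 := by
      simpa [hq] using congrArg (fun r => coeff r j) h0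
    have h2 : (Q.coeff j).eval 1 = 0 := by
      have h3 := aeval_algebraMap_apply ℝ (1 : ℤ) (Q.coeff j)
      rw [map_one, h1] at h3
      simpa using h3.symm
    simpa using dvd_iff_isRoot.mpr h2
  have hlim : Tendsto (fun k => q.eval (t k)) atTop (𝓝 0) := by
    have hterm : ∀ j, Tendsto (fun k =>
        (aeval (1 : ℝ) (Q.coeff j) - aeval (x k) (Q.coeff j)) * t k ^ j) atTop (𝓝 0) := by
      intro j
      obtain ⟨r, hr⟩ : (X - C 1 : ℤ[X]) ∣ Q.coeff j - C ((Q.coeff j).eval 1) :=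
        dvd_iff_isRoot.mpr (by simp)
      have hval : ∀ y : ℝ, aeval y (Q.coeff j) = (y - 1) * aeval y r + ((Q.coeff j).eval 1 : ℤ) := by
        intro y
        rw [sub_eq_iff_eq_add.mp hr]
        simp
      have hr1 : Tendsto (fun k => aeval (x k) r) atTop (𝓝 (aeval (1 : ℝ) r)) :=
        (r.continuous_aeval.tendsto 1).comp hx
      have := ((hxt j).mul hr1).neg
      rw [zero_mul, neg_zero] at this
      refine this.congr fun k => ?_
      rw [hval, hval]
      ring
    have hsum := tendsto_finsetSum (Finset.range (Q.natDegree + 1)) fun j _ => hterm j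
    rw [Finset.sum_const_zero] at hsum
    refine hsum.congr fun k => ?_
    have h1 := hQ0 k
    rw [eval₂_eq_sum_range] at h1
    simp_rw [sub_mul]
    rw [hq, eval_map, eval₂_eq_sum_range, Finset.sum_sub_distrib]
    exact sub_eq_self.mpr h1
  rcases le_or_gt q.degree 0 with hd | hd
  · rw [eq_C_of_degree_le_zero hd] at hlim hq0
    simp only [eval_C] at hlim
    exact hq0 (by rw [tendsto_nhds_unique tendsto_const_nhds hlim, C_0])
  · have h1 := (q.abs_tendsto_atTop hd).comp ht
    exact not_tendsto_nhds_of_tendsto_atTop h1 _ hlim.abs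

namespace discSeries

/-- The Mahler functional equation `f x = f (x ^ 2) + x / (1 + x ^ 2)` on the open unit interval. -/
def IsMahler (f : discSeries) : Prop :=
  ∀ (x : ℝ) (hx : |x| < 1) (hx2 : |x ^ 2| < 1), eval x hx f = eval (x ^ 2) hx2 f + x / (1 + x ^ 2)

/-- The points `2 ^ (-1 / 2 ^ k)`, which tend to `1` and on which squaring is the shift. -/
noncomputable def sqrtIter : ℕ → ℝ
  | 0 => 1 / 2
  | k + 1 => √(sqrtIter k)

theorem half_le_sqrtIter_lt_one (k : ℕ) : 1 / 2 ≤ sqrtIter k ∧ sqrtIter k < 1 := by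
  induction k with
  | zero => norm_num [sqrtIter]
  | succ k ih =>
    refine ⟨Real.le_sqrt_of_sq_le (by linarith), ?_⟩
    rw [sqrtIter, Real.sqrt_lt' one_pos]
    linarith

theorem abs_sqrtIter_lt_one (k : ℕ) : |sqrtIter k| < 1 := by
  have := half_le_sqrtIter_lt_one k
  rw [abs_of_nonneg (by linarith)]
  exact this.2

theorem sqrtIter_succ_sq (k : ℕ) : sqrtIter (k + 1) ^ 2 = sqrtIter k :=
  Real.sq_sqrt (by linarith [half_le_sqrtIter_lt_one k])

theorem one_sub_sqrtIter_le (k : ℕ) : 1 - sqrtIter k ≤ (2 / 3) ^ k := by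
  induction k with
  | zero => norm_num [sqrtIter]
  | succ k ih =>
    have h1 := sqrtIter_succ_sq k
    have h2 := half_le_sqrtIter_lt_one (k + 1)
    rw [pow_succ]
    nlinarith

open Filter Topology

/-- Along `sqrtIter`, a solution of the functional equation grows linearly in `k`, since each step
adds a value of `x / (1 + x ^ 2)`, which is between `2 / 5` and `1 / 2`. -/
theorem IsMahler.eval_sqrtIter_bounds {f : discSeries} (hf : IsMahler f) (k : ℕ) :
    eval (sqrtIter 0) (abs_sqrtIter_lt_one 0) f + 2 / 5 * k ≤
        eval (sqrtIter k) (abs_sqrtIter_lt_one k) f ∧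
      eval (sqrtIter k) (abs_sqrtIter_lt_one k) f ≤
        eval (sqrtIter 0) (abs_sqrtIter_lt_one 0) f + 1 / 2 * k := by
  induction k with
  | zero => simp
  | succ k ih =>
    have h1 := hf _ (abs_sqrtIter_lt_one (k + 1))
      (by rw [sqrtIter_succ_sq]; exact abs_sqrtIter_lt_one k)
    simp only [sqrtIter_succ_sq] at h1
    have h2 := half_le_sqrtIter_lt_one (k + 1)
    have h3 := half_le_sqrtIter_lt_one k
    have h4 := sqrtIter_succ_sq k
    have h5 : 2 / 5 ≤ sqrtIter (k + 1) / (1 + sqrtIter k) := by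
      rw [le_div_iff₀ (by linarith)]
      nlinarith
    have h6 : sqrtIter (k + 1) / (1 + sqrtIter k) ≤ 1 / 2 := by
      rw [div_le_iff₀ (by linarith)]
      nlinarith [sq_nonneg (sqrtIter (k + 1) - 1)]
    push_cast
    constructor <;> linarith

/-- A solution of the functional equation is transcendental over the polynomials: it grows only
logarithmically at `1`. -/
theorem IsMahler.eq_zero_of_sum_eq_zero {f : discSeries} (hf : IsMahler f) (m : ℕ)
    (c : Fin m × Fin m → ℤ)
    (hc : ∑ ij, (c ij : discSeries) * X ^ (ij.1 : ℕ) * f ^ (ij.2 : ℕ) = 0) : c = 0 := by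
  set P : Polynomial (Polynomial ℤ) := ∑ ij, Polynomial.monomial (ij.2 : ℕ)
    (Polynomial.monomial (ij.1 : ℕ) (c ij)) with hPdef
  have hP : P = 0 := by
    refine eq_zero_of_eval₂_eq_zero_of_tendsto (x := sqrtIter)
      (t := fun k => eval (sqrtIter k) (abs_sqrtIter_lt_one k) f)
      (fun k => (half_le_sqrtIter_lt_one k).2.ne) ?_ ?_ ?_ ?_
    · have h1 : Tendsto (fun k : ℕ => 1 - (2 / 3 : ℝ) ^ k) atTop (𝓝 1) := by
        simpa using (tendsto_pow_atTop_nhds_zero_of_lt_one (r := (2 / 3 : ℝ)) (by norm_num)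
          (by norm_num)).const_sub 1
      exact tendsto_of_tendsto_of_tendsto_of_le_of_le h1 tendsto_const_nhds
        (fun k => by linarith [one_sub_sqrtIter_le k]) fun k => (half_le_sqrtIter_lt_one k).2.le
    · refine tendsto_atTop_mono (fun k => (hf.eval_sqrtIter_bounds k).1)
        (tendsto_atTop_add_const_left _ _ ?_)
      exact tendsto_natCast_atTop_atTop.const_mul_atTop (by norm_num)
    · intro j
      set A := |eval (sqrtIter 0) (abs_sqrtIter_lt_one 0) f| + 1 with hA
      have h1 : Tendsto (fun k : ℕ => A ^ j * (3 / 2) *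
          (((k + 1 : ℕ) : ℝ) ^ j * (2 / 3 : ℝ) ^ (k + 1))) atTop (𝓝 0) := by
        simpa using ((tendsto_add_atTop_iff_nat 1).mpr
          (tendsto_pow_const_mul_const_pow_of_abs_lt_one j (r := 2 / 3)
            (by norm_num [abs_of_pos]))).const_mul (A ^ j * (3 / 2))
      refine squeeze_zero_norm (fun k => ?_) h1
      have hb := hf.eval_sqrtIter_bounds k
      have hA1 := abs_le.mp (le_refl |eval (sqrtIter 0) (abs_sqrtIter_lt_one 0) f|)
      have hA0 := abs_nonneg (eval (sqrtIter 0) (abs_sqrtIter_lt_one 0) f)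
      have hk : (0 : ℝ) ≤ k := k.cast_nonneg
      have ht : |eval (sqrtIter k) (abs_sqrtIter_lt_one k) f| ≤ A * (k + 1 : ℕ) := by
        push_cast
        rw [abs_le]
        constructor <;> nlinarith
      have hx : |sqrtIter k - 1| ≤ (2 / 3) ^ k := by
        rw [abs_sub_comm, abs_of_nonneg (by linarith [half_le_sqrtIter_lt_one k])]
        exact one_sub_sqrtIter_le k
      rw [norm_mul, norm_pow, Real.norm_eq_abs, Real.norm_eq_abs]
      calc _ ≤ (2 / 3 : ℝ) ^ k * (A * (k + 1 : ℕ)) ^ j := by gcongr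
        _ = _ := by rw [mul_pow, pow_succ (2 / 3 : ℝ)]; ring
    · intro k
      have h := congrArg (eval (sqrtIter k) (abs_sqrtIter_lt_one k)) hc
      rw [map_sum, map_zero] at h
      rw [hPdef, Polynomial.eval₂_finsetSum, ← h]
      refine Finset.sum_congr rfl fun ij _ => ?_
      simp [Polynomial.eval₂_monomial, Polynomial.aeval_monomial, eval_X]
  ext ⟨i, j⟩
  have h1 := congrArg (fun Q => (Q.coeff (j : ℕ)).coeff (i : ℕ)) hP
  simp only [hPdef, Polynomial.finsetSum_coeff, Polynomial.coeff_monomial, Polynomial.coeff_zero]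
    at h1
  rw [Finset.sum_eq_single (i, j)] at h1
  · simpa using h1
  · rintro ⟨i', j'⟩ _ hne
    by_cases hj : (j' : ℕ) = j
    · have hi : (i' : ℕ) ≠ i := fun hi => hne (by rw [Fin.ext hi, Fin.ext hj])
      simp [hj, Polynomial.coeff_monomial, hi]
    · simp [hj]
  · simp

/-- By counting unknowns and equations, there is a nonzero polynomial in `x` and `f`, of
degree less than `m` in each, that vanishes at `0` to any given order `N < m * m`. -/
theorem exists_coeff_sum_eq_zero (f : discSeries) {m N : ℕ} (h : N < m * m) :
    ∃ c : Fin m × Fin m → ℤ, c ≠ 0 ∧ ∀ n < N,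
      ((∑ ij, (c ij : discSeries) * X ^ (ij.1 : ℕ) * f ^ (ij.2 : ℕ) : discSeries) :
        PowerSeries ℤ).coeff n = 0 := by
  let L : (Fin m × Fin m → ℤ) →ₗ[ℤ] (Fin N → ℤ) :=
    { toFun := fun c n => ∑ ij, c ij * ((X ^ (ij.1 : ℕ) * f ^ (ij.2 : ℕ) : discSeries) :
        PowerSeries ℤ).coeff n
      map_add' := fun a b => by
        ext n
        simp [add_mul, Finset.sum_add_distrib]
      map_smul' := fun a b => by
        ext n
        simp [mul_assoc, Finset.mul_sum] }
  have hL : ¬ Function.Injective L := fun hi => by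
    have := card_le_of_injective ℤ L hi
    simp only [Fintype.card_prod, Fintype.card_fin] at this
    omega
  rw [← LinearMap.ker_eq_bot, Submodule.eq_bot_iff] at hL
  push Not at hL
  obtain ⟨c, hc, hc0⟩ := hL
  refine ⟨c, hc0, fun n hn => ?_⟩
  have h1 := congrFun (LinearMap.mem_ker.mp hc) ⟨n, hn⟩
  rw [AddSubmonoidClass.coe_finsetSum, map_sum]
  refine Eq.trans (Finset.sum_congr rfl fun ij _ => ?_) h1
  rw [mul_assoc, Subring.coe_mul, Subring.coe_intCast, ← zsmul_eq_mul, map_zsmul, smul_eq_mul]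

end discSeries

/-! ### Transcendence at `1 / 2` -/

open Module in
/-- Liouville's inequality: the norm of a nonzero algebraic integer is at least `1` in absolute
value, so no conjugate of it is small compared with the others. -/
theorem one_le_norm_mul_pow_of_isIntegral {K : Type*} [Field K] [NumberField K] {y : K}
    (hy : IsIntegral ℤ y) (hy0 : y ≠ 0) {H : ℝ} (hH : ∀ σ : K →ₐ[ℚ] ℂ, ‖σ y‖ ≤ H)
    (φ : K →ₐ[ℚ] ℂ) : 1 ≤ ‖φ y‖ * H ^ (finrank ℚ K - 1) := by
  obtain ⟨n, hn⟩ := IsIntegrallyClosed.isIntegral_iff.mp (Algebra.isIntegral_norm ℚ hy)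
  have hn0 : n ≠ 0 := by
    rintro rfl
    rw [map_zero] at hn
    exact hy0 (Algebra.norm_eq_zero_iff.mp hn.symm)
  have hprod := Algebra.norm_eq_prod_embeddings ℚ ℂ y
  rw [← hn] at hprod
  have h1 : (1 : ℝ) ≤ ‖∏ σ : K →ₐ[ℚ] ℂ, σ y‖ := by
    rw [← hprod]
    simpa using (by exact_mod_cast Int.one_le_abs hn0 : (1 : ℝ) ≤ |(n : ℝ)|)
  classical
  rw [← Finset.mul_prod_erase _ _ (Finset.mem_univ φ), norm_mul, norm_prod] at h1
  refine h1.trans (mul_le_mul_of_nonneg_left ?_ (norm_nonneg _))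
  refine (Finset.prod_le_prod (fun _ _ => norm_nonneg _) fun σ _ => hH σ).trans_eq ?_
  rw [Finset.prod_const, Finset.card_erase_of_mem (Finset.mem_univ φ), Finset.card_univ,
    AlgHom.card]

/-- A lower bound for the nonzero values of a fixed integer polynomial at the points
`(1 / B, θ - s / D)`, where `θ` is algebraic and `s / D` is bounded. The exponent is linear in
the degree of the polynomial. -/
theorem exists_one_le_mul_abs_sum {θ : ℝ} (hθ : IsAlgebraic ℚ θ) :
    ∃ d : ℕ, ∀ (m : ℕ) (c : Fin m × Fin m → ℤ) (M : ℝ), ∃ C : ℝ, 0 ≤ C ∧ ∀ B D s : ℤ,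
      1 ≤ B → 1 ≤ D → D ≤ B ^ 2 → |(s : ℝ) / D| ≤ M →
      ∑ ij, (c ij : ℝ) * (1 / B) ^ (ij.1 : ℕ) * (θ - s / D) ^ (ij.2 : ℕ) ≠ 0 →
      1 ≤ C * (B : ℝ) ^ (3 * m * d) *
        |∑ ij, (c ij : ℝ) * (1 / B) ^ (ij.1 : ℕ) * (θ - s / D) ^ (ij.2 : ℕ)| := by
  have hθ' : IsAlgebraic ℚ (θ : ℂ) := (isAlgebraic_algebraMap_iff (S := ℝ) (A := ℂ)
    (algebraMap ℝ ℂ).injective).mpr hθ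
  let K := IntermediateField.adjoin ℚ {(θ : ℂ)}
  have : FiniteDimensional ℚ K := IntermediateField.adjoin.finiteDimensional hθ'.isIntegral
  have : NumberField K := ⟨⟩
  let ϑ : K := IntermediateField.AdjoinSimple.gen ℚ (θ : ℂ)
  let φ : K →ₐ[ℚ] ℂ := K.val
  have hφ : φ ϑ = θ := rfl
  have halg : IsAlgebraic ℤ ϑ :=
    (IsFractionRing.isAlgebraic_iff ℤ ℚ K).mpr (Algebra.IsAlgebraic.isAlgebraic ϑ)
  obtain ⟨a, ha0, ha⟩ := halg.exists_integral_multiple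
  rw [zsmul_eq_mul] at ha
  refine ⟨Module.finrank ℚ K, fun m c M => ?_⟩
  set T : ℝ := 1 + |M| + ∑ σ : K →ₐ[ℚ] ℂ, ‖σ ϑ‖ with hT
  have hsum0 : 0 ≤ ∑ σ : K →ₐ[ℚ] ℂ, ‖σ ϑ‖ := Finset.sum_nonneg fun _ _ => norm_nonneg _
  have hT1 : 1 ≤ T := by linarith [abs_nonneg M]
  set C₀ : ℝ := |(a : ℝ)| ^ m * (∑ ij, |(c ij : ℝ)|) * T ^ m with hC₀
  have hC₀0 : 0 ≤ C₀ := by positivity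
  refine ⟨|(a : ℝ)| ^ m * C₀ ^ (Module.finrank ℚ K - 1), by positivity, ?_⟩
  intro B D s hB hD hDB hs hS
  have hB0 : (0 : ℝ) < B := by exact_mod_cast hB
  have hB1 : (1 : ℝ) ≤ B := by exact_mod_cast hB
  have hD0 : (0 : ℝ) < D := by exact_mod_cast hD
  have hDB' : (D : ℝ) ≤ (B : ℝ) ^ 2 := by exact_mod_cast hDB
  -- the value of the polynomial, cleared of denominators, in the number field
  set y : K := ((a : K) * D * B) ^ m *
    ∑ ij, (c ij : K) * (1 / B) ^ (ij.1 : ℕ) * (ϑ - s / D) ^ (ij.2 : ℕ) with hy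
  have hBK : (B : K) ≠ 0 := by exact_mod_cast (by omega : B ≠ 0)
  have hDK : (D : K) ≠ 0 := by exact_mod_cast (by omega : D ≠ 0)
  have hZ : ∀ z : ℤ, IsIntegral ℤ (z : K) := fun z => isIntegral_algebraMap
  have hyint : IsIntegral ℤ y := by
    rw [hy, Finset.mul_sum]
    refine IsIntegral.sum _ fun ij _ => ?_
    have hterm : ((a : K) * D * B) ^ m *
        ((c ij : K) * (1 / B) ^ (ij.1 : ℕ) * (ϑ - s / D) ^ (ij.2 : ℕ)) =
        c ij * (a * D) ^ (m - (ij.2 : ℕ)) * B ^ (m - (ij.1 : ℕ)) *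
          (D * (a * ϑ) - a * s) ^ (ij.2 : ℕ) := by
      have e1 : ((a : K) * D) ^ m = (a * D) ^ (m - (ij.2 : ℕ)) * (a * D) ^ (ij.2 : ℕ) := by
        rw [← pow_add, Nat.sub_add_cancel ij.2.2.le]
      have e2 : (B : K) ^ m = B ^ (m - (ij.1 : ℕ)) * B ^ (ij.1 : ℕ) := by
        rw [← pow_add, Nat.sub_add_cancel ij.1.2.le]
      have e3 : (B : K) ^ (ij.1 : ℕ) * (1 / B) ^ (ij.1 : ℕ) = 1 := by
        rw [← mul_pow, mul_one_div_cancel hBK, one_pow]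
      have e4 : (D : K) * (a * ϑ) - a * s = a * D * (ϑ - s / D) := by
        field_simp
      rw [e4, mul_pow _ (ϑ - s / D), mul_pow _ (B : K), e1, e2]
      linear_combination (c ij * (a * D) ^ (m - (ij.2 : ℕ)) * B ^ (m - (ij.1 : ℕ)) *
        (a * D) ^ (ij.2 : ℕ) * (ϑ - s / D) ^ (ij.2 : ℕ) : K) * e3
    rw [hterm]
    exact ((((hZ _).mul (((hZ _).mul (hZ _)).pow _)).mul ((hZ _).pow _)).mul
      ((((hZ _).mul ha).sub ((hZ _).mul (hZ _))).pow _))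
  have hσy : ∀ σ : K →ₐ[ℚ] ℂ, σ y = ((a : ℂ) * D * B) ^ m *
      ∑ ij, (c ij : ℂ) * (1 / B) ^ (ij.1 : ℕ) * (σ ϑ - s / D) ^ (ij.2 : ℕ) := by
    intro σ
    simp [hy]
  have hφy : ‖φ y‖ = (|(a : ℝ)| * D * B) ^ m *
      |∑ ij, (c ij : ℝ) * (1 / B) ^ (ij.1 : ℕ) * (θ - s / D) ^ (ij.2 : ℕ)| := by
    rw [hσy, hφ, ← Real.norm_eq_abs (Finset.sum _ _), ← Complex.norm_real, norm_mul, norm_pow,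
      norm_mul, norm_mul, Complex.norm_intCast, Complex.norm_intCast, Complex.norm_intCast,
      abs_of_pos hD0, abs_of_pos hB0]
    push_cast
    rfl
  have hy0 : y ≠ 0 := by
    intro h0
    rw [h0, map_zero, norm_zero] at hφy
    have ha0' : (0 : ℝ) < |(a : ℝ)| := abs_pos.mpr (by exact_mod_cast ha0)
    have : 0 < (|(a : ℝ)| * D * B) ^ m := by positivity
    exact hS (abs_eq_zero.mp ((mul_eq_zero.mp hφy.symm).resolve_left this.ne'))
  have hDBm : ((D : ℝ) * B) ^ m ≤ (B : ℝ) ^ (3 * m) := by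
    rw [pow_mul]
    gcongr
    rw [pow_succ _ 2]
    gcongr
  have hH : ∀ σ : K →ₐ[ℚ] ℂ, ‖σ y‖ ≤ C₀ * (B : ℝ) ^ (3 * m) := by
    intro σ
    have hσ : ‖σ ϑ - s / D‖ ≤ T := by
      have h1 : ‖σ ϑ‖ ≤ ∑ σ : K →ₐ[ℚ] ℂ, ‖σ ϑ‖ :=
        Finset.single_le_sum (f := fun σ : K →ₐ[ℚ] ℂ => ‖σ ϑ‖) (fun _ _ => norm_nonneg _)
          (Finset.mem_univ σ)
      have h2 : ‖(s / D : ℂ)‖ ≤ |M| := by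
        have h3 : (s / D : ℂ) = ((s / D : ℝ) : ℂ) := by push_cast; rfl
        rw [h3, Complex.norm_real]
        exact hs.trans (le_abs_self M)
      linarith [norm_sub_le (σ ϑ) (s / D)]
    have hsum : ‖∑ ij, (c ij : ℂ) * (1 / B) ^ (ij.1 : ℕ) * (σ ϑ - s / D) ^ (ij.2 : ℕ)‖ ≤
        (∑ ij, |(c ij : ℝ)|) * T ^ m := by
      rw [Finset.sum_mul]
      refine norm_sum_le_of_le _ fun ij _ => ?_
      rw [norm_mul, norm_mul, norm_pow, norm_pow, Complex.norm_intCast]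
      have h1 : ‖(1 / B : ℂ)‖ ^ (ij.1 : ℕ) ≤ 1 := by
        refine pow_le_one₀ (norm_nonneg _) ?_
        rw [norm_div, norm_one, Complex.norm_intCast, abs_of_pos hB0]
        exact div_le_one_of_le₀ hB1 hB0.le
      have h2 : ‖σ ϑ - s / D‖ ^ (ij.2 : ℕ) ≤ T ^ m :=
        (pow_le_pow_left₀ (norm_nonneg _) hσ _).trans (pow_le_pow_right₀ hT1 ij.2.2.le)
      calc _ ≤ |(c ij : ℝ)| * 1 * T ^ m := by gcongr
        _ = _ := by ring
    rw [hσy, norm_mul, norm_pow, norm_mul, norm_mul, Complex.norm_intCast, Complex.norm_intCast,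
      Complex.norm_intCast, abs_of_pos hD0, abs_of_pos hB0]
    calc _ ≤ (|(a : ℝ)| * D * B) ^ m * ((∑ ij, |(c ij : ℝ)|) * T ^ m) := by gcongr
      _ = C₀ * ((D : ℝ) * B) ^ m := by rw [hC₀, mul_assoc |(a : ℝ)|, mul_pow]; ring
      _ ≤ _ := by gcongr
  have hd : 3 * m * (Module.finrank ℚ K - 1) + 3 * m = 3 * m * Module.finrank ℚ K := by
    have : 1 ≤ Module.finrank ℚ K := Module.finrank_pos
    rw [← Nat.mul_succ, Nat.succ_eq_add_one, Nat.sub_add_cancel this]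
  refine (one_le_norm_mul_pow_of_isIntegral hyint hy0 hH φ).trans ?_
  rw [hφy, ← hd, pow_add, pow_mul (B : ℝ) (3 * m), mul_pow C₀]
  calc _ = |(a : ℝ)| ^ m * ((D : ℝ) * B) ^ m *
        |∑ ij, (c ij : ℝ) * (1 / B) ^ (ij.1 : ℕ) * (θ - s / D) ^ (ij.2 : ℕ)| *
        (C₀ ^ (Module.finrank ℚ K - 1) * ((B : ℝ) ^ (3 * m)) ^ (Module.finrank ℚ K - 1)) := by
          rw [mul_assoc |(a : ℝ)|, mul_pow |(a : ℝ)|]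
    _ ≤ |(a : ℝ)| ^ m * (B : ℝ) ^ (3 * m) *
        |∑ ij, (c ij : ℝ) * (1 / B) ^ (ij.1 : ℕ) * (θ - s / D) ^ (ij.2 : ℕ)| *
        (C₀ ^ (Module.finrank ℚ K - 1) * ((B : ℝ) ^ (3 * m)) ^ (Module.finrank ℚ K - 1)) := by
          gcongr
    _ = _ := by ring

namespace discSeries

theorem abs_half_pow_lt_one (k : ℕ) : |(1 / 2 : ℝ) ^ 2 ^ k| < 1 := by
  rw [abs_of_pos (by positivity)]
  exact pow_lt_one₀ (by norm_num) (by norm_num) (by positivity)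

/-- Iterating the functional equation from `1 / 2`. -/
theorem IsMahler.eval_half_pow {f : discSeries} (hf : IsMahler f) (k : ℕ) :
    eval _ (abs_half_pow_lt_one k) f = eval _ (abs_half_pow_lt_one 0) f -
      ∑ i ∈ Finset.range k, (1 / 2 : ℝ) ^ 2 ^ i / (1 + ((1 / 2 : ℝ) ^ 2 ^ i) ^ 2) := by
  induction k with
  | zero => simp
  | succ k ih =>
    have hsq : ((1 / 2 : ℝ) ^ 2 ^ k) ^ 2 = (1 / 2) ^ 2 ^ (k + 1) := by
      rw [← pow_mul, pow_succ 2 k]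
    have h1 := hf _ (abs_half_pow_lt_one k) (by rw [hsq]; exact abs_half_pow_lt_one (k + 1))
    rw [ih] at h1
    rw [Finset.sum_range_succ]
    simp only [hsq] at h1 ⊢
    linarith

/-- The partial sums have denominator `∏ i ≤ k, (2 ^ 2 ^ i + 1) / 3`, a product of Fermat numbers
that telescopes. -/
theorem exists_sum_half_pow_eq_div (k : ℕ) : ∃ D s : ℤ, 3 * D + 1 = (2 ^ 2 ^ k) ^ 2 ∧
    ∑ i ∈ Finset.range k, (1 / 2 : ℝ) ^ 2 ^ i / (1 + ((1 / 2 : ℝ) ^ 2 ^ i) ^ 2) = (s : ℝ) / D := by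
  induction k with
  | zero => exact ⟨1, 0, by norm_num, by simp⟩
  | succ k ih =>
    obtain ⟨D, s, hD, hs⟩ := ih
    set B : ℤ := 2 ^ 2 ^ k with hB
    have hB2 : (2 : ℤ) ^ 2 ^ (k + 1) = B ^ 2 := by rw [hB, ← pow_mul, pow_succ 2 k]
    have hB0 : 2 ≤ B := by
      calc (2 : ℤ) = 2 ^ 1 := by norm_num
        _ ≤ _ := pow_le_pow_right₀ (by norm_num) Nat.one_le_two_pow
    have hD0 : D ≠ 0 := by
      rintro rfl
      nlinarith
    refine ⟨D * (B ^ 2 + 1), s * (B ^ 2 + 1) + D * B, ?_, ?_⟩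
    · rw [hB2]
      linear_combination (B ^ 2 + 1) * hD
    · have hBr : (1 / 2 : ℝ) ^ 2 ^ k = 1 / B := by simp [hB]
      have hB0' : (B : ℝ) ≠ 0 := by exact_mod_cast (by omega : B ≠ 0)
      have hD0' : (D : ℝ) ≠ 0 := by exact_mod_cast hD0
      rw [Finset.sum_range_succ, hs, hBr]
      push_cast
      field_simp

/-- Mahler's theorem: with auxiliary polynomials of degree `m` in each variable the function
vanishes to an order about `m ^ 2`, while Liouville's inequality along `1 / 2 ^ 2 ^ k` permits
only an order linear in `m`. -/
theorem IsMahler.transcendental_eval_half {f : discSeries} (hf : IsMahler f) :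
    Transcendental ℚ (eval _ (abs_half_pow_lt_one 0) f) := by
  intro halg
  set θ := eval _ (abs_half_pow_lt_one 0) f with hθ
  obtain ⟨d, hd⟩ := exists_one_le_mul_abs_sum halg
  -- the order `N` exceeds Liouville's exponent `3 * m * d` and is below the number of unknowns
  set m := 3 * d + 2 with hm
  set N := 3 * m * d + m with hN
  have hNm : N < m * m := by rw [hN, hm]; nlinarith
  obtain ⟨c, hc0, hc⟩ := exists_coeff_sum_eq_zero f hNm
  set E : discSeries := ∑ ij, (c ij : discSeries) * X ^ (ij.1 : ℕ) * f ^ (ij.2 : ℕ) with hE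
  have hE0 : E ≠ 0 := fun h => hc0 (hf.eq_zero_of_sum_eq_zero m c h)
  obtain ⟨δ, hδ, hEδ⟩ := exists_eval_ne_zero E hE0
  obtain ⟨C, hC0, hC⟩ := hd m c (2 * halfNorm f)
  obtain ⟨k, hk⟩ := exists_nat_gt (max (1 / δ) (C * 2 ^ N * halfNorm E))
  have hkB : (k : ℝ) < 2 ^ 2 ^ k := by
    exact_mod_cast Nat.lt_two_pow_self.trans Nat.lt_two_pow_self
  obtain ⟨D, s, hDB, hs⟩ := exists_sum_half_pow_eq_div k
  set B : ℤ := 2 ^ 2 ^ k with hB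
  have hBr : ((B : ℤ) : ℝ) = 2 ^ 2 ^ k := by simp [hB]
  have hx : (1 / 2 : ℝ) ^ 2 ^ k = 1 / B := by simp [hB]
  have hB2 : 2 ≤ B := by
    calc (2 : ℤ) = 2 ^ 1 := by norm_num
      _ ≤ _ := pow_le_pow_right₀ (by norm_num) Nat.one_le_two_pow
  have hB0 : (0 : ℝ) < B := by exact_mod_cast (by omega : 0 < B)
  have hB1 : (1 : ℝ) ≤ B := by exact_mod_cast (by omega : 1 ≤ B)
  have hfk := hf.eval_half_pow k
  rw [hs, ← hθ] at hfk
  have hxhalf : (1 / 2 : ℝ) ^ 2 ^ k ≤ 1 / 2 :=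
    pow_le_of_le_one (by norm_num) (by norm_num) (by positivity)
  have hsum : eval _ (abs_half_pow_lt_one k) E =
      ∑ ij, (c ij : ℝ) * (1 / B) ^ (ij.1 : ℕ) * (θ - s / D) ^ (ij.2 : ℕ) := by
    rw [hE, map_sum]
    refine Finset.sum_congr rfl fun ij _ => ?_
    rw [map_mul, map_mul, map_pow, map_pow, eval_X, hfk, map_intCast, hx]
  have hne : eval _ (abs_half_pow_lt_one k) E ≠ 0 := by
    refine hEδ _ _ (by positivity) ?_
    rw [hx, div_lt_comm₀ hB0 hδ, hBr]
    exact (le_max_left _ _).trans_lt (hk.trans hkB)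
  have hM : |(s : ℝ) / D| ≤ 2 * halfNorm f := by
    have h1 := (abs_eval_le f (N := 0) (by simp) (abs_half_pow_lt_one k) (by positivity)
      hxhalf).trans_eq (by rw [pow_zero, one_mul])
    have h2 := (abs_eval_le f (N := 0) (by simp) (abs_half_pow_lt_one 0) (by positivity)
      (by norm_num)).trans_eq (by rw [pow_zero (2 * _), one_mul])
    rw [hfk, abs_le] at h1
    rw [← hθ, abs_le] at h2
    rw [abs_le]
    constructor <;> linarith [h1.1, h1.2, h2.1, h2.2]
  have hlow := hC B D s (by omega) (by nlinarith) (by nlinarith) hM (hsum ▸ hne)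
  rw [← hsum] at hlow
  have hup : |eval _ (abs_half_pow_lt_one k) E| ≤ (2 * (1 / B)) ^ N * halfNorm E :=
    (abs_eval_le E hc (abs_half_pow_lt_one k) (by positivity) hxhalf).trans_eq (by rw [hx])
  have hcontr : (1 : ℝ) ≤ C * 2 ^ N * halfNorm E / B := by
    calc (1 : ℝ) ≤ C * (B : ℝ) ^ (3 * m * d) * |eval _ (abs_half_pow_lt_one k) E| := hlow
      _ ≤ C * (B : ℝ) ^ (3 * m * d) * ((2 * (1 / B)) ^ N * halfNorm E) := by gcongr
      _ = C * 2 ^ N * halfNorm E / (B : ℝ) ^ m := by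
        rw [hN, mul_pow, pow_add (1 / (B : ℝ)), one_div_pow, one_div_pow]
        field_simp
      _ ≤ C * 2 ^ N * halfNorm E / B := by
        have := halfNorm_nonneg E
        gcongr
        exact le_self_pow₀ hB1 (by omega)
  rw [le_div_iff₀ hB0, one_mul, hBr] at hcontr
  exact absurd ((le_max_right _ _).trans_lt (hk.trans hkB)) (not_lt.mpr hcontr)

end discSeries

/-! ### The Gaussian Liouville function -/

theorem gaussLiouville_eq_chi_four {n : ℕ} (hn : Odd n) : gaussLiouville n = ZMod.χ₄ n := by
  induction n using induction_on_primes with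
  | zero => simp at hn
  | one => simp [gaussLiouville_one]
  | prime_mul p a hp ih =>
    obtain ⟨hp1, ha⟩ := Nat.odd_mul.mp hn
    have ha0 : a ≠ 0 := by rintro rfl; simp at ha
    rw [gaussLiouville_mul hp.ne_zero ha0, ih ha, gaussLiouville_prime hp, Nat.cast_mul, map_mul]
    congr 1
    have h2 := Nat.odd_iff.mp hp1
    rcases (by omega : p % 4 = 1 ∨ p % 4 = 3) with h | h
    · rw [ZMod.χ₄_nat_one_mod_four h, if_neg (by omega)]
    · rw [ZMod.χ₄_nat_three_mod_four h, if_pos h]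

theorem gaussLiouville_two_mul_add_one (n : ℕ) : gaussLiouville (2 * n + 1) = (-1) ^ n := by
  rw [gaussLiouville_eq_chi_four (odd_two_mul_add_one n), ZMod.χ₄_eq_neg_one_pow (by omega)]
  congr 1
  omega

theorem gaussLiouville_two_mul {n : ℕ} (hn : n ≠ 0) : gaussLiouville (2 * n) = gaussLiouville n := by
  rw [gaussLiouville_mul two_ne_zero hn, gaussLiouville_prime Nat.prime_two]
  simp

theorem abs_gaussLiouville (n : ℕ) : |gaussLiouville n| = 1 := by
  unfold gaussLiouville
  induction n.primeFactorsList with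
  | nil => simp
  | cons p l ih =>
    rw [List.map_cons, List.prod_cons, abs_mul, ih]
    split_ifs <;> simp

/-- The generating function of the Gaussian Liouville function as a convergent power series, with
constant term `0`. -/
noncomputable def gaussLiouvilleSeries : discSeries :=
  ⟨PowerSeries.mk fun n => if n = 0 then 0 else gaussLiouville n, fun x hx => by
    refine Summable.of_nonneg_of_le (fun _ => norm_nonneg _) (fun n => ?_)
      (summable_geometric_of_lt_one (abs_nonneg x) hx)
    rw [PowerSeries.coeff_mk, norm_mul, norm_pow, Real.norm_eq_abs x]
    refine mul_le_of_le_one_left (by positivity) ?_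
    split_ifs
    · simp
    · rw [Real.norm_eq_abs]
      exact_mod_cast (abs_gaussLiouville n).le⟩

theorem coeff_gaussLiouvilleSeries (n : ℕ) :
    (gaussLiouvilleSeries : PowerSeries ℤ).coeff n = if n = 0 then 0 else gaussLiouville n := by
  simp [gaussLiouvilleSeries]

theorem hasSum_gaussLiouvilleSeries {x : ℝ} (hx : |x| < 1) :
    HasSum (fun n : ℕ => (gaussLiouville (n + 1) : ℝ) * x ^ (n + 1))
      (discSeries.eval x hx gaussLiouvilleSeries) := by
  have h := discSeries.hasSum_eval gaussLiouvilleSeries hx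
  rw [← hasSum_nat_add_iff' 1] at h
  simpa [coeff_gaussLiouvilleSeries] using h

/-- The terms of even index sum to the value at `x ^ 2`, and those of odd index form a geometric
series. -/
theorem isMahler_gaussLiouvilleSeries : discSeries.IsMahler gaussLiouvilleSeries := by
  intro x hx hx2
  have he : HasSum (fun n : ℕ =>
      ((gaussLiouvilleSeries : PowerSeries ℤ).coeff (2 * n) : ℝ) * x ^ (2 * n))
      (discSeries.eval (x ^ 2) hx2 gaussLiouvilleSeries) := by
    refine (discSeries.hasSum_eval gaussLiouvilleSeries hx2).congr_fun fun n => ?_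
    rw [coeff_gaussLiouvilleSeries, coeff_gaussLiouvilleSeries, pow_mul]
    rcases eq_or_ne n 0 with rfl | hn
    · simp
    · rw [if_neg hn, if_neg (by omega), gaussLiouville_two_mul hn]
  have ho : HasSum (fun n : ℕ =>
      ((gaussLiouvilleSeries : PowerSeries ℤ).coeff (2 * n + 1) : ℝ) * x ^ (2 * n + 1))
      (x / (1 + x ^ 2)) := by
    have h := (hasSum_geometric_of_abs_lt_one (r := -x ^ 2) (by rwa [abs_neg])).mul_left x
    rw [sub_neg_eq_add, ← div_eq_mul_inv] at h
    refine h.congr_fun fun n => ?_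
    rw [coeff_gaussLiouvilleSeries, if_neg (by omega), gaussLiouville_two_mul_add_one, pow_succ,
      pow_mul, neg_pow (x ^ 2)]
    push_cast
    ring
  exact (discSeries.hasSum_eval gaussLiouvilleSeries hx).unique (he.even_add_odd ho)

open discSeries Filter Topology in
/-- The values at `1 / 2 ^ 2 ^ k` tend to `0`, since the constant term is `0`, so the iterated
functional equation becomes a convergent series. -/
theorem hasSum_half_pow_gaussLiouvilleSeries :
    HasSum (fun k : ℕ => (1 / 2 : ℝ) ^ 2 ^ k / (1 + ((1 / 2 : ℝ) ^ 2 ^ k) ^ 2))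
      (eval _ (abs_half_pow_lt_one 0) gaussLiouvilleSeries) := by
  rw [hasSum_iff_tendsto_nat_of_nonneg fun k => by positivity]
  have hx : Tendsto (fun k : ℕ => (1 / 2 : ℝ) ^ 2 ^ k) atTop (𝓝 0) :=
    (tendsto_pow_atTop_nhds_zero_of_lt_one (by norm_num) (by norm_num)).comp
      (tendsto_pow_atTop_atTop_of_one_lt one_lt_two)
  have h0 : Tendsto (fun k => eval _ (abs_half_pow_lt_one k) gaussLiouvilleSeries) atTop (𝓝 0) := by
    refine squeeze_zero_norm (a := fun k => 2 * (1 / 2 : ℝ) ^ 2 ^ k * halfNorm gaussLiouvilleSeries)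
      (fun k => ?_) (by simpa using (hx.const_mul 2).mul_const (halfNorm gaussLiouvilleSeries))
    refine (abs_eval_le gaussLiouvilleSeries (N := 1) ?_ (abs_half_pow_lt_one k) (by positivity)
      (pow_le_of_le_one (by norm_num) (by norm_num) (by positivity))).trans_eq (by rw [pow_one])
    intro n hn
    rw [coeff_gaussLiouvilleSeries, if_pos (by omega)]
  have h1 := h0.const_sub (eval _ (abs_half_pow_lt_one 0) gaussLiouvilleSeries)
  rw [sub_zero] at h1
  refine h1.congr fun k => ?_
  rw [isMahler_gaussLiouvilleSeries.eval_half_pow k]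
  ring

open discSeries in
theorem mainTheorem1 :
    HasSum (fun n : ℕ => ((1 + (gaussLiouville (n + 1) : ℝ)) / 2) * (1 / 2 ^ (n + 1)))
      gaussLiouvilleNumber ∧
    HasSum (fun n : ℕ => (gaussLiouville (n + 1) : ℂ) * (1 / 2 : ℂ) ^ (n + 1))
      (gaussLiouvilleGenFun (1 / 2)) ∧
    HasSum (fun k : ℕ => 1 / ((2 : ℂ) ^ (2 ^ k : ℕ) + (2 : ℂ) ^ (-(2 ^ k : ℤ))))
      (gaussLiouvilleGenFun (1 / 2)) ∧
    (gaussLiouvilleNumber : ℂ) = (1 + gaussLiouvilleGenFun (1 / 2)) / 2 ∧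
    Transcendental ℚ gaussLiouvilleNumber ∧
    Transcendental ℚ (gaussLiouvilleGenFun (1 / 2)) := by
  set θ : ℝ := eval _ (abs_half_pow_lt_one 0) gaussLiouvilleSeries with hθ
  have hG : HasSum (fun n : ℕ => (gaussLiouville (n + 1) : ℝ) * (1 / 2) ^ (n + 1)) θ := by
    have h := hasSum_gaussLiouvilleSeries (abs_half_pow_lt_one 0)
    rw [hθ]
    simpa only [pow_zero, pow_one] using h
  have hGC : HasSum (fun n : ℕ => (gaussLiouville (n + 1) : ℂ) * (1 / 2 : ℂ) ^ (n + 1)) (θ : ℂ) := by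
    refine (Complex.hasSum_ofReal.mpr hG).congr_fun fun n => ?_
    push_cast
    rfl
  have hGen : gaussLiouvilleGenFun (1 / 2) = θ := hGC.tsum_eq
  have hγ : HasSum (fun n : ℕ => ((1 + (gaussLiouville (n + 1) : ℝ)) / 2) * (1 / 2 ^ (n + 1)))
      ((1 + θ) / 2) := by
    have h1 : HasSum (fun n : ℕ => (1 / 2 : ℝ) ^ (n + 1)) 1 := by
      have h := hasSum_geometric_two.mul_left (1 / 2 : ℝ)
      norm_num only at h
      exact h.congr_fun fun n => pow_succ' _ _
    refine ((h1.add hG).div_const 2).congr_fun fun n => ?_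
    rw [one_div_pow]
    ring
  have hNum : gaussLiouvilleNumber = (1 + θ) / 2 := hγ.tsum_eq
  have htr : Transcendental ℚ θ := isMahler_gaussLiouvilleSeries.transcendental_eval_half
  rw [hNum, hGen]
  refine ⟨hγ, hGC, ?_, by push_cast; rfl, fun h => htr ?_,
    (transcendental_algebraMap_iff (S := ℝ) (A := ℂ) (algebraMap ℝ ℂ).injective).mpr htr⟩
  · refine (Complex.hasSum_ofReal.mpr hasSum_half_pow_gaussLiouvilleSeries).congr_fun fun k => ?_
    have hz : (2 : ℂ) ^ (-(2 ^ k : ℤ)) = (2 ^ 2 ^ k)⁻¹ := by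
      rw [zpow_neg]
      norm_cast
    have hB : (2 : ℂ) ^ 2 ^ k ≠ 0 := pow_ne_zero _ two_ne_zero
    rw [hz]
    push_cast
    rw [one_div_pow]
    field_simp
  · have h2 : θ = algebraMap ℚ ℝ 2 * ((1 + θ) / 2) - algebraMap ℚ ℝ 1 := by
      simp
      ring
    rw [h2]
    exact ((isAlgebraic_algebraMap _).mul h).sub (isAlgebraic_algebraMap _)
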